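/- Let $P^1,P^2\subset\mathbb R^4$ be two-dimensional linear subspaces. Let $(v_1,w_1)$ be a pair of unit vectors $v_1\in P^1$, $w_1\in P^2$ minimizing the angle among all such pairs, and let $\alpha_1$ be that minimal angle; let $\alpha_2$ be the minimal angle between unit vectors $v\in P^1$, $w\in P^2$ with $v\perp v_1$ and $w\perp w_1$. Then $\alpha_1\le\alpha_2$ are called the characteristic angles of $P^1$ and $P^2$. A set $E\subset\mathbb R^4$ is called $2$-rectifiable if there are countably many Lipschitz maps $f_i:\mathbb R^2\to\mathbb R^4$ with $H^2\big(E\setminus\bigcup_i f_i(\mathbb R^2)\big)=0$, where $H^2$ is the two-dimensional Hausdorff measure, normalized to agree with area on planes. Corollary 2.45. Let $\epsilon>0$ and let $P^1,P^2\subset\mathbb R^4$ be two planes through the origin whose characteristic angles satisfy $\arccos(\epsilon/2)\le\alpha_1\le\alpha_2$ (with the convention $\arccos t=0$ for $t>1$). Denote by $p^i$ the orthogonal projection of $\mathbb R^4$ onto $P^i$, $i=1,2$. If $E\subset\mathbb R^4$ is a closed $2$-rectifiable set with $p^i(E)\supset B(0,1)\cap P^i$ for $i=1,2$, where $B(0,1)$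 is the open unit ball of $\mathbb R^4$, then $$H^2(E)\ \ge\ \frac{2\pi}{1+\epsilon}.$$ -/

import Mathlib

open MeasureTheory

/-- `ℝ⁴` with its Euclidean norm. -/
abbrev E4 : Type := EuclideanSpace ℝ (Fin 4)

/-- `(v, w)` is an admissible pair: unit vectors with `v ∈ P` and `w ∈ Q`. -/
def IsUnitPair (P Q : Submodule ℝ E4) (v w : E4) : Prop :=
  v ∈ P ∧ w ∈ Q ∧ ‖v‖ = 1 ∧ ‖w‖ = 1

/-- `(α₁, α₂)` is the pair of characteristic angles of the planes `P` and `Q`: `α₁` is the minimum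
of the angle between unit vectors of `P` and of `Q`, attained at a pair `(v₁, w₁)`, and `α₂` is the
minimum of the angle between unit vectors `v ∈ P`, `w ∈ Q` with `v ⟂ v₁` and `w ⟂ w₁`, attained at
a pair `(v₂, w₂)`. -/
def AreCharacteristicAngles (P Q : Submodule ℝ E4) (α₁ α₂ : ℝ) : Prop :=
  ∃ v₁ w₁ : E4, IsUnitPair P Q v₁ w₁ ∧
    (∀ v w : E4, IsUnitPair P Q v w →
      InnerProductGeometry.angle v₁ w₁ ≤ InnerProductGeometry.angle v w) ∧
    α₁ = InnerProductGeometry.angle v₁ w₁ ∧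
    ∃ v₂ w₂ : E4, IsUnitPair P Q v₂ w₂ ∧ inner ℝ v₂ v₁ = 0 ∧ inner ℝ w₂ w₁ = 0 ∧
      (∀ v w : E4, IsUnitPair P Q v w → inner ℝ v v₁ = 0 → inner ℝ w w₁ = 0 →
        InnerProductGeometry.angle v₂ w₂ ≤ InnerProductGeometry.angle v w) ∧
      α₂ = InnerProductGeometry.angle v₂ w₂

/-- A set `E ⊆ ℝⁿ` is `m`-rectifiable if countably many Lipschitz images of `ℝᵐ` cover `E` up to a
set of `m`-dimensional Hausdorff measure zero. -/
def IsRectifiable (m : ℕ) {n : ℕ} (E : Set (EuclideanSpace ℝ (Fin n))) : Prop :=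
  ∃ f : ℕ → EuclideanSpace ℝ (Fin m) → EuclideanSpace ℝ (Fin n),
    (∀ i, ∃ K : NNReal, LipschitzWith K (f i)) ∧
    μHE[m] (E \ ⋃ i, Set.range (f i)) = 0

open Filter Set Topology
open scoped NNReal ENNReal

/-! The angle condition gives `⟪v, w⟫ ≤ c‖v‖‖w‖` on `P₁ × P₂` with `c = ε / 2`. Hence a unit vector
`u` satisfies `‖p¹u‖² + ‖p²u‖² ≤ 1 + c`. Summing over an orthonormal basis of any plane, Hadamard
and AM-GM bound the sum of the two projection Jacobians by `1 + c < 1 + ε`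
(`abs_det_planeProjection_add_le`).

The strict gap absorbs linearization errors, so no area formula is needed. Lipschitz
parametrizations split into countably many pieces close to an injective linear map, plus a part with
null projections. On each piece the two projected areas add up to at most `(1 + ε) H²`, and summing
gives this for `E` (`IsRectifiable.volume_image_add_le`). Each projection covers a unit disc, so the
left side is at least `2π`. -/

/-- The Euclidean plane. -/
abbrev E2 : Type := EuclideanSpace ℝ (Fin 2)

/-- Isometric coordinates on a plane of `ℝ⁴`. -/
noncomputable def planeIsometry (P : Submodule ℝ E4) (hP : Module.finrank ℝ P = 2) : P ≃ₗᵢ[ℝ] E2 :=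
  ((stdOrthonormalBasis ℝ P).reindex (finCongr hP)).repr

/-! ### Linear estimates -/

theorem abs_det_le_norm_mul_norm (B : E2 →L[ℝ] E2) :
    |B.det| ≤ ‖B (EuclideanSpace.single 0 1)‖ * ‖B (EuclideanSpace.single 1 1)‖ := by
  have hdet : B.det = (B (EuclideanSpace.single 0 1)) 0 * (B (EuclideanSpace.single 1 1)) 1
      - (B (EuclideanSpace.single 1 1)) 0 * (B (EuclideanSpace.single 0 1)) 1 := by
    change LinearMap.det (B : E2 →ₗ[ℝ] E2) = _
    rw [← LinearMap.det_toMatrix (EuclideanSpace.basisFun (Fin 2) ℝ).toBasis, Matrix.det_fin_two]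
    simp [LinearMap.toMatrix_apply]
  rw [hdet]
  generalize B (EuclideanSpace.single 0 1) = x
  generalize B (EuclideanSpace.single 1 1) = y
  refine abs_le_of_sq_le_sq ?_ (by positivity)
  rw [mul_pow, EuclideanSpace.real_norm_sq_eq, EuclideanSpace.real_norm_sq_eq,
    Fin.sum_univ_two, Fin.sum_univ_two]
  nlinarith [sq_nonneg (x 0 * y 0 + x 1 * y 1)]

/-- With `x`, `y` the projections of `u` and `s = ‖x‖² + ‖y‖²`, one has `s = ⟪x + y, u⟫ ≤ ‖x + y‖`,
while `‖x + y‖² ≤ (1 + c) s` by AM-GM. So `s² ≤ (1 + c) s`. -/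
theorem norm_sq_starProjection_add_le {P Q : Submodule ℝ E4} {c : ℝ} (hc : 0 ≤ c)
    (hPQ : ∀ v ∈ P, ∀ w ∈ Q, inner ℝ v w ≤ c * ‖v‖ * ‖w‖) {u : E4} (hu : ‖u‖ = 1) :
    ‖P.starProjection u‖ ^ 2 + ‖Q.starProjection u‖ ^ 2 ≤ 1 + c := by
  set x := P.starProjection u
  set y := Q.starProjection u
  have hx : inner ℝ x u = ‖x‖ ^ 2 := by
    simpa using Submodule.re_inner_starProjection_eq_normSq (K := P) u
  have hy : inner ℝ y u = ‖y‖ ^ 2 := by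
    simpa using Submodule.re_inner_starProjection_eq_normSq (K := Q) u
  have hxy := hPQ x (Submodule.starProjection_apply_mem P u) y
    (Submodule.starProjection_apply_mem Q u)
  have h1 : ‖x‖ ^ 2 + ‖y‖ ^ 2 ≤ ‖x + y‖ := by
    have := real_inner_le_norm (x + y) u
    rwa [inner_add_left, hx, hy, hu, mul_one] at this
  have h2 : ‖x + y‖ ^ 2 = ‖x‖ ^ 2 + 2 * inner ℝ x y + ‖y‖ ^ 2 := norm_add_sq_real x y
  by_contra! h
  have h3 : (‖x‖ ^ 2 + ‖y‖ ^ 2) ^ 2 ≤ ‖x + y‖ ^ 2 := by gcongr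
  have h4 : 2 * inner ℝ x y ≤ c * (‖x‖ ^ 2 + ‖y‖ ^ 2) := by
    nlinarith [mul_nonneg hc (sq_nonneg (‖x‖ - ‖y‖))]
  nlinarith

/-! ### Area bound near a linear map -/

/-- A function close to a linear isometry has Lipschitz inverse. -/
theorem volume_le_of_approximatesLinearOn_isometry {U : E2 →ₗᵢ[ℝ] E4} {s : Set E2} {f : E2 → E4}
    {η : ℝ≥0} (hη : η < 1) (h : ApproximatesLinearOn f U.toContinuousLinearMap s η) :
    volume s ≤ ((1 - η)⁻¹ ^ 2 : ℝ≥0) * μHE[2] (f '' s) := by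
  have hpos : 0 < 1 - η := tsub_pos_of_lt hη
  have key : ∀ x ∈ s, ∀ y ∈ s, dist x y ≤ ((1 - η)⁻¹ : ℝ≥0) * dist (f x) (f y) := by
    intro x hx y hy
    have h1 := h x hx y hy
    have h2 : ‖x - y‖ ≤ ‖f x - f y‖ + ‖f x - f y - U (x - y)‖ := by
      rw [← U.norm_map (x - y)]
      calc _ = ‖(f x - f y) - (f x - f y - U (x - y))‖ := by congr 1; abel
        _ ≤ _ := norm_sub_le _ _
    rw [NNReal.coe_inv, NNReal.coe_sub hη.le, dist_eq_norm, dist_eq_norm, inv_mul_eq_div,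
      le_div_iff₀ (by rw [← NNReal.coe_sub hη.le]; exact_mod_cast hpos)]
    have h1' : ‖f x - f y - U (x - y)‖ ≤ η * ‖x - y‖ := h1
    push_cast
    linarith
  have hinj : InjOn f s := by
    intro x hx y hy hxy
    have := key x hx y hy
    rw [hxy, dist_self, mul_zero] at this
    exact dist_le_zero.1 this
  have hlip : LipschitzOnWith (1 - η)⁻¹ (Function.invFunOn f s) (f '' s) := by
    refine LipschitzOnWith.of_dist_le_mul ?_
    rintro _ ⟨x, hx, rfl⟩ _ ⟨y, hy, rfl⟩
    rw [hinj.leftInvOn_invFunOn hx, hinj.leftInvOn_invFunOn hy]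
    exact key x hx y hy
  have hle := hlip.hausdorffMeasure_image_le (d := (2 : ℕ)) (by positivity)
  rw [hinj.leftInvOn_invFunOn.image_image] at hle
  rw [← EuclideanSpace.euclideanHausdorffMeasure_eq_volume, Measure.euclideanHausdorffMeasure_def,
    Measure.euclideanHausdorffMeasure_def, Measure.smul_apply, Measure.smul_apply,
    ENNReal.smul_def, ENNReal.smul_def, smul_eq_mul, smul_eq_mul, mul_left_comm]
  gcongr
  simpa only [Nat.cast_ofNat, ENNReal.rpow_ofNat, ENNReal.coe_pow] using hle

/-- A bound on the total area of the images of a set under `q₁` and `q₂`, for sets parametrized by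
maps close to a linear isometry. -/
theorem exists_volume_image_add_le_of_isometry (q₁ q₂ : E4 →L[ℝ] E2) (U : E2 →ₗᵢ[ℝ] E4)
    {K : ℝ≥0} (hK : |(q₁ ∘L U.toContinuousLinearMap).det| +
      |(q₂ ∘L U.toContinuousLinearMap).det| < K) :
    ∃ η : ℝ≥0, 0 < η ∧ ∀ (s : Set E2) (f : E2 → E4),
      ApproximatesLinearOn f U.toContinuousLinearMap s η →
        volume (q₁ '' (f '' s)) + volume (q₂ '' (f '' s)) ≤ K * μHE[2] (f '' s) := by
  set d₁ := |(q₁ ∘L U.toContinuousLinearMap).det| with hd₁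
  set d₂ := |(q₂ ∘L U.toContinuousLinearMap).det| with hd₂
  have n₁ : 0 ≤ d₁ := abs_nonneg _
  have n₂ : 0 ≤ d₂ := abs_nonneg _
  -- Each determinant gets an error `t`; what remains of the gap pays for the factor `(1 - η)⁻²`.
  obtain ⟨t, ht0, ht⟩ : ∃ t : ℝ, 0 < t ∧ d₁ + d₂ + 2 * t < K :=
    ⟨(K - (d₁ + d₂)) / 4, by linarith, by linarith⟩
  have small : ∀ q : E4 →L[ℝ] E2, ∀ d : ℝ, 0 ≤ d → d = |(q ∘L U.toContinuousLinearMap).det| →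
      ∀ᶠ η : ℝ≥0 in 𝓝[>] 0, ∀ (s : Set E2) (f : E2 → E4),
        ApproximatesLinearOn f U.toContinuousLinearMap s η →
          volume (q '' (f '' s)) ≤ (d + t).toNNReal * volume s := by
    intro q d hd hdq
    have h1 : ENNReal.ofReal |(q ∘L U.toContinuousLinearMap).det| < (d + t).toNNReal := by
      rw [← hdq]
      exact (ENNReal.ofReal_lt_ofReal_iff (by linarith)).2 (by linarith)
    have h2 := addHaar_image_le_mul_of_det_lt volume _ h1
    have h3 : Tendsto (fun η : ℝ≥0 => (‖q‖₊ + 1) * η) (𝓝[>] 0) (𝓝[>] 0) := by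
      refine tendsto_nhdsWithin_iff.2 ⟨?_, ?_⟩
      · have : Tendsto (fun η : ℝ≥0 => (‖q‖₊ + 1) * η) (𝓝 0) (𝓝 ((‖q‖₊ + 1) * 0)) :=
          (continuous_const.mul continuous_id).tendsto 0
        rw [mul_zero] at this
        exact this.mono_left nhdsWithin_le_nhds
      · filter_upwards [self_mem_nhdsWithin] with η hη
        have hη' : 0 < η := hη
        exact mem_Ioi.2 (by positivity)
    filter_upwards [h3.eventually h2] with η hη s f hf
    rw [← image_comp]
    refine hη s (q ∘ f) fun x hx y hy => ?_
    have h4 := hf x hx y hy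
    calc ‖q (f x) - q (f y) - q (U (x - y))‖ = ‖q (f x - f y - U (x - y))‖ := by simp
      _ ≤ ‖q‖ * ‖f x - f y - U (x - y)‖ := q.le_opNorm _
      _ ≤ (‖q‖ + 1) * (η * ‖x - y‖) := by
          gcongr
          · linarith
          · exact h4
      _ = _ := by push_cast; ring
  have hlim : ∀ᶠ η : ℝ≥0 in 𝓝[>] 0,
      ((d₁ + t).toNNReal + (d₂ + t).toNNReal) * (1 - η)⁻¹ ^ 2 < K := by
    have h1 : Tendsto (fun η : ℝ≥0 => ((d₁ + t).toNNReal + (d₂ + t).toNNReal) * (1 - η)⁻¹ ^ 2)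
        (𝓝 0) (𝓝 (((d₁ + t).toNNReal + (d₂ + t).toNNReal) * (1 - 0)⁻¹ ^ 2)) := by
      have h2 : Tendsto (fun η : ℝ≥0 => 1 - η) (𝓝 0) (𝓝 (1 - 0)) :=
        (continuous_const.sub continuous_id).tendsto 0
      exact ((h2.inv₀ (by simp)).pow 2).const_mul _
    refine nhdsWithin_le_nhds (h1.eventually_lt_const ?_)
    rw [tsub_zero, inv_one, one_pow, mul_one, ← Real.toNNReal_add (by linarith) (by linarith),
      Real.toNNReal_lt_iff_lt_coe (by linarith)]
    linarith
  have hone : ∀ᶠ η : ℝ≥0 in 𝓝[>] 0, η < 1 :=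
    nhdsWithin_le_nhds (eventually_lt_nhds zero_lt_one)
  obtain ⟨η, ⟨⟨⟨h1, h2⟩, h3⟩, h4⟩, h5⟩ := ((((small q₁ d₁ n₁ hd₁).and (small q₂ d₂ n₂ hd₂)).and
    hlim).and hone).and self_mem_nhdsWithin |>.exists
  refine ⟨η, h5, fun s f hf => ?_⟩
  calc _ ≤ (d₁ + t).toNNReal * volume s + (d₂ + t).toNNReal * volume s :=
        add_le_add (h1 s f hf) (h2 s f hf)
    _ = ((d₁ + t).toNNReal + (d₂ + t).toNNReal : ℝ≥0) * volume s := by push_cast; ring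
    _ ≤ ((d₁ + t).toNNReal + (d₂ + t).toNNReal : ℝ≥0) *
          (((1 - η)⁻¹ ^ 2 : ℝ≥0) * μHE[2] (f '' s)) := by
        gcongr
        exact volume_le_of_approximatesLinearOn_isometry h4 hf
    _ ≤ K * μHE[2] (f '' s) := by
        rw [← mul_assoc, ← ENNReal.coe_mul]
        gcongr

/-- Factor `L = U ∘ S` with `U` an isometry and `S` invertible. Replacing `f` by `f ∘ S⁻¹` on `S ''
s` keeps the image and costs a factor controlled by `‖S⁻¹‖` in `η`. -/
theorem exists_volume_image_add_le_of_injective {q₁ q₂ : E4 →L[ℝ] E2} {K : ℝ≥0}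
    (hK : ∀ U : E2 →ₗᵢ[ℝ] E4, |(q₁ ∘L U.toContinuousLinearMap).det| +
      |(q₂ ∘L U.toContinuousLinearMap).det| < K)
    (L : E2 →L[ℝ] E4) (hL : Function.Injective L) :
    ∃ η : ℝ≥0, 0 < η ∧ ∀ (s : Set E2) (f : E2 → E4), ApproximatesLinearOn f L s η →
      volume (q₁ '' (f '' s)) + volume (q₂ '' (f '' s)) ≤ K * μHE[2] (f '' s) := by
  let e := LinearEquiv.ofInjective (L : E2 →ₗ[ℝ] E4) hL
  have hrank : Module.finrank ℝ (LinearMap.range (L : E2 →ₗ[ℝ] E4)) = 2 := by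
    rw [← e.finrank_eq]; simp
  let J := planeIsometry (LinearMap.range (L : E2 →ₗ[ℝ] E4)) hrank
  let S : E2 ≃L[ℝ] E2 := (e.trans J.toLinearEquiv).toContinuousLinearEquiv
  let U : E2 →ₗᵢ[ℝ] E4 :=
    (LinearMap.range (L : E2 →ₗ[ℝ] E4)).subtypeₗᵢ.comp J.symm.toLinearIsometry
  have hUS : ∀ x, U (S x) = L x := by
    intro x
    change ((J.symm (J (e x)) : LinearMap.range (L : E2 →ₗ[ℝ] E4)) : E4) = L x
    rw [J.symm_apply_apply]
    rfl
  obtain ⟨η, hη, h⟩ := exists_volume_image_add_le_of_isometry q₁ q₂ U (hK U)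
  set c : ℝ≥0 := ‖(S.symm : E2 →L[ℝ] E2)‖₊ + 1 with hc
  have hc0 : 0 < c := by positivity
  refine ⟨η / c, by positivity, fun s f hf => ?_⟩
  have h1 : (f ∘ S.symm) '' (S '' s) = f '' s := by
    rw [← image_comp]
    exact image_congr fun x _ => by simp
  have h2 := h (S '' s) (f ∘ S.symm) ?_
  · rwa [h1] at h2
  rintro _ ⟨x, hx, rfl⟩ _ ⟨y, hy, rfl⟩
  have h3 := hf x hx y hy
  have h4 : ‖x - y‖ ≤ c * ‖S x - S y‖ := by
    have := (S.symm : E2 →L[ℝ] E2).le_opNorm (S x - S y)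
    rw [← map_sub] at this
    simp only [ContinuousLinearEquiv.coe_coe, ContinuousLinearEquiv.symm_apply_apply] at this
    refine this.trans ?_
    rw [← map_sub]
    gcongr
    rw [hc]
    push_cast
    linarith
  have h5 : U.toContinuousLinearMap (S x - S y) = L (x - y) := by
    rw [← map_sub]; exact hUS _
  rw [h5]
  simp only [Function.comp_apply, ContinuousLinearEquiv.symm_apply_apply]
  calc _ ≤ (η / c : ℝ≥0) * ‖x - y‖ := h3
    _ ≤ (η / c : ℝ≥0) * (c * ‖S x - S y‖) := by gcongr
    _ = η * ‖S x - S y‖ := by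
      rw [← mul_assoc, ← NNReal.coe_mul, div_mul_cancel₀ _ hc0.ne']

/-! ### Lipschitz parametrizations: null part and good pieces -/

theorem volume_image_eq_zero_of_lipschitzWith {g : E2 → E2} {C : ℝ≥0} (hg : LipschitzWith C g)
    {s : Set E2} (hs : volume s = 0) : volume (g '' s) = 0 := by
  have h := hg.hausdorffMeasure_image_le (d := (2 : ℕ)) (by positivity) s
  rw [← EuclideanSpace.euclideanHausdorffMeasure_eq_volume, Measure.euclideanHausdorffMeasure_def,
    Measure.smul_apply, ENNReal.smul_def, smul_eq_mul, mul_eq_zero, ENNReal.coe_eq_zero] at hs ⊢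
  refine Or.inr (le_antisymm (h.trans ?_) zero_le)
  rw [hs.resolve_left (Measure.addHaarScalarFactor_volume_hausdorffMeasure_ne_zero 2), mul_zero]

theorem det_comp_eq_zero_of_not_injective (q : E4 →L[ℝ] E2) {L : E2 →L[ℝ] E4}
    (hL : ¬ Function.Injective L) : (q ∘L L).det = 0 := by
  by_contra h
  refine hL fun x y hxy => ?_
  exact (((q ∘L L : E2 →L[ℝ] E2) : E2 →ₗ[ℝ] E2).equivOfDetNeZero h).injective
    (show q (L x) = q (L y) by rw [hxy])

/-- Up to a set with negligible images, the domain of a Lipschitz map is covered by countably many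
closed sets on whose images the total area bound holds. -/
theorem LipschitzWith.exists_closed_cover_volume_image_add_le {q₁ q₂ : E4 →L[ℝ] E2} {K : ℝ≥0}
    (hK : ∀ U : E2 →ₗᵢ[ℝ] E4, |(q₁ ∘L U.toContinuousLinearMap).det| +
      |(q₂ ∘L U.toContinuousLinearMap).det| < K)
    {f : E2 → E4} {C : ℝ≥0} (hf : LipschitzWith C f) :
    ∃ (T : ℕ → Set E2) (Z : Set E2), (∀ n, IsClosed (T n)) ∧ Z ∪ ⋃ n, T n = univ ∧
      volume (q₁ '' (f '' Z)) = 0 ∧ volume (q₂ '' (f '' Z)) = 0 ∧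
      ∀ n, ∀ M ⊆ f '' T n, volume (q₁ '' M) + volume (q₂ '' M) ≤ K * μHE[2] M := by
  set N : Set E2 := {x | ¬ DifferentiableAt ℝ f x}
  set D : Set E2 := {x | DifferentiableAt ℝ f x ∧ ¬ Function.Injective (fderiv ℝ f x)}
  set G : Set E2 := {x | DifferentiableAt ℝ f x ∧ Function.Injective (fderiv ℝ f x)}
  have hcov : (N ∪ D) ∪ G = univ := by
    refine eq_univ_of_forall fun x => ?_
    by_cases h1 : DifferentiableAt ℝ f x
    · by_cases h2 : Function.Injective (fderiv ℝ f x)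
      · exact Or.inr ⟨h1, h2⟩
      · exact Or.inl (Or.inr ⟨h1, h2⟩)
    · exact Or.inl (Or.inl h1)
  have hZ : ∀ q : E4 →L[ℝ] E2, volume (q '' (f '' (N ∪ D))) = 0 := by
    intro q
    rw [image_union, image_union, measure_union_null_iff]
    constructor
    · rw [← image_comp]
      exact volume_image_eq_zero_of_lipschitzWith (q.lipschitz.comp hf) hf.ae_differentiableAt
    · rw [← image_comp]
      refine addHaar_image_eq_zero_of_det_fderivWithin_eq_zero volume
        (f' := fun x => q ∘L fderiv ℝ f x) (fun x hx => ?_) fun x hx => ?_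
      · exact (q.hasFDerivAt.comp x hx.1.hasFDerivAt).hasFDerivWithinAt
      · exact det_comp_eq_zero_of_not_injective q hx.2
  have hr : ∀ L : E2 →L[ℝ] E4, ∃ η : ℝ≥0, η ≠ 0 ∧ (Function.Injective L →
      ∀ (s : Set E2) (f : E2 → E4), ApproximatesLinearOn f L s η →
        volume (q₁ '' (f '' s)) + volume (q₂ '' (f '' s)) ≤ K * μHE[2] (f '' s)) := by
    intro L
    by_cases hL : Function.Injective L
    · obtain ⟨η, h1, h2⟩ := exists_volume_image_add_le_of_injective hK L hL
      exact ⟨η, h1.ne', fun _ => h2⟩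
    -- A dummy radius: the approximating maps of nonempty pieces are derivatives at points of `G`,
    -- hence injective.
    · exact ⟨1, one_ne_zero, fun h => absurd h hL⟩
  choose r hr0 hr using hr
  obtain ⟨t, A, -, htG, happ, hA⟩ := exists_closed_cover_approximatesLinearOn_of_hasFDerivWithinAt
    f G (fderiv ℝ f) (fun x hx => hx.1.hasFDerivAt.hasFDerivWithinAt) r hr0
  refine ⟨fun n => closure (G ∩ t n), N ∪ D, fun n => isClosed_closure, ?_, hZ q₁, hZ q₂, ?_⟩
  · rw [← univ_subset_iff, ← hcov]
    refine union_subset_union_right _ fun x hx => ?_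
    obtain ⟨n, hn⟩ := mem_iUnion.1 (htG hx)
    exact mem_iUnion.2 ⟨n, subset_closure ⟨hx, hn⟩⟩
  · intro n M hM
    rcases (G ∩ t n).eq_empty_or_nonempty with hemp | ⟨x, hx⟩
    · have : M = ∅ := by simpa [hemp] using hM
      simp [this]
    obtain ⟨y, hy, hAy⟩ := hA ⟨x, hx.1⟩ n
    -- The approximation passes to the closure by continuity of `f`; closed pieces have Borel
    -- images.
    have happ' : ApproximatesLinearOn f (A n) (closure (G ∩ t n)) (r (A n)) := by
      rw [ApproximatesLinearOn.approximatesLinearOn_iff_lipschitzOnWith]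
      refine LipschitzOnWith.closure ?_ (ApproximatesLinearOn.approximatesLinearOn_iff_lipschitzOnWith.1 (happ n))
      exact (hf.continuous.sub (A n).continuous).continuousOn
    have hM' : f '' (closure (G ∩ t n) ∩ f ⁻¹' M) = M := by
      rw [image_inter_preimage, inter_eq_right.2 hM]
    have := hr (A n) (hAy ▸ hy.2) _ f (happ'.mono_set (inter_subset_left (t := f ⁻¹' M)))
    rwa [hM'] at this

/-! ### Summation over a countable cover -/

/-- If the area bound holds on all subsets of countably many measurable sets and the rest of `E` has
negligible images, then it holds on `E`. -/
theorem volume_image_add_le_of_cover {q₁ q₂ : E4 →L[ℝ] E2} {K : ℝ≥0} {E N : Set E4}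
    {A : ℕ → Set E4} (hE : MeasurableSet E) (hA : ∀ n, MeasurableSet (A n))
    (hcov : E ⊆ N ∪ ⋃ n, A n) (h₁ : volume (q₁ '' N) = 0) (h₂ : volume (q₂ '' N) = 0)
    (h : ∀ n, ∀ M ⊆ A n, volume (q₁ '' M) + volume (q₂ '' M) ≤ K * μHE[2] M) :
    volume (q₁ '' E) + volume (q₂ '' E) ≤ K * μHE[2] E := by
  -- Disjoint measurable pieces make `μHE[2]` additive; the projected areas only need subadditivity.
  have hsub : E ⊆ N ∪ ⋃ n, E ∩ disjointed A n := by
    intro x hx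
    rcases hcov hx with h | h
    · exact Or.inl h
    · rw [← iUnion_disjointed] at h
      rw [← inter_iUnion]
      exact Or.inr ⟨hx, h⟩
  have hq : ∀ q : E4 →L[ℝ] E2, volume (q '' N) = 0 →
      volume (q '' E) ≤ ∑' n, volume (q '' (E ∩ disjointed A n)) := by
    intro q hq
    calc volume (q '' E) ≤ volume (q '' N ∪ ⋃ n, q '' (E ∩ disjointed A n)) := by
          refine measure_mono ?_
          rw [← image_iUnion, ← image_union]
          exact image_mono hsub
      _ ≤ volume (q '' N) + volume (⋃ n, q '' (E ∩ disjointed A n)) := measure_union_le _ _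
      _ ≤ _ := by rw [hq, zero_add]; exact measure_iUnion_le _
  calc _ ≤ ∑' n, volume (q₁ '' (E ∩ disjointed A n)) +
        ∑' n, volume (q₂ '' (E ∩ disjointed A n)) := add_le_add (hq q₁ h₁) (hq q₂ h₂)
    _ = ∑' n, (volume (q₁ '' (E ∩ disjointed A n)) + volume (q₂ '' (E ∩ disjointed A n))) :=
        ENNReal.tsum_add.symm
    _ ≤ ∑' n, K * μHE[2] (E ∩ disjointed A n) :=
        ENNReal.tsum_le_tsum fun n => h n _ (inter_subset_right.trans (disjointed_le A n))
    _ = K * μHE[2] (⋃ n, E ∩ disjointed A n) := by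
        rw [ENNReal.tsum_mul_left, measure_iUnion]
        · exact fun i j hij => (disjoint_disjointed A hij).mono inter_subset_right
            inter_subset_right
        · exact fun n => hE.inter (MeasurableSet.disjointed hA n)
    _ ≤ K * μHE[2] E := by
        gcongr
        exact iUnion_subset fun n => inter_subset_left

theorem volume_image_eq_zero_of_euclideanHausdorffMeasure_eq_zero (q : E4 →L[ℝ] E2) {s : Set E4}
    (hs : μHE[2] s = 0) : volume (q '' s) = 0 := by
  have h := q.lipschitz.hausdorffMeasure_image_le (d := (2 : ℕ)) (by positivity) s
  rw [← EuclideanSpace.euclideanHausdorffMeasure_eq_volume]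
  rw [Measure.euclideanHausdorffMeasure_def,
    Measure.smul_apply, ENNReal.smul_def, smul_eq_mul, mul_eq_zero, ENNReal.coe_eq_zero] at hs ⊢
  refine Or.inr (le_antisymm (h.trans ?_) zero_le)
  rw [hs.resolve_left (Measure.addHaarScalarFactor_volume_hausdorffMeasure_ne_zero 2), mul_zero]

theorem IsRectifiable.volume_image_add_le {q₁ q₂ : E4 →L[ℝ] E2} {K : ℝ≥0}
    (hK : ∀ U : E2 →ₗᵢ[ℝ] E4, |(q₁ ∘L U.toContinuousLinearMap).det| +
      |(q₂ ∘L U.toContinuousLinearMap).det| < K)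
    {E : Set E4} (hE : MeasurableSet E) (hrect : IsRectifiable 2 E) :
    volume (q₁ '' E) + volume (q₂ '' E) ≤ K * μHE[2] E := by
  obtain ⟨f, hf, hnull⟩ := hrect
  choose C hC using hf
  choose T Z hT hcov hZ₁ hZ₂ hM using
    fun i => (hC i).exists_closed_cover_volume_image_add_le hK
  have hN : ∀ q : E4 →L[ℝ] E2, (∀ i, volume (q '' (f i '' Z i)) = 0) →
      volume (q '' ((E \ ⋃ i, range (f i)) ∪ ⋃ i, f i '' Z i)) = 0 := by
    intro q hq
    rw [image_union, image_iUnion, measure_union_null_iff, measure_iUnion_null_iff]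
    exact ⟨volume_image_eq_zero_of_euclideanHausdorffMeasure_eq_zero q hnull, hq⟩
  refine volume_image_add_le_of_cover hE
    (A := fun k => f k.unpair.1 '' T k.unpair.1 k.unpair.2) (fun k => ?_) ?_ (hN q₁ hZ₁)
    (hN q₂ hZ₂) fun k => hM _ _
  · obtain ⟨c, hc, hc'⟩ := (isSigmaCompact_univ.of_isClosed_subset
      (hT k.unpair.1 k.unpair.2) (subset_univ _)).image (hC k.unpair.1).continuous
    rw [← hc']
    exact MeasurableSet.iUnion fun n => (hc n).measurableSet
  · intro x hx
    by_cases h : x ∈ ⋃ i, range (f i)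
    · obtain ⟨i, y, rfl⟩ := mem_iUnion.1 h
      rcases (hcov i ▸ mem_univ y : y ∈ Z i ∪ ⋃ n, T i n) with hy | hy
      · exact Or.inl (Or.inr (mem_iUnion.2 ⟨i, y, hy, rfl⟩))
      · obtain ⟨n, hn⟩ := mem_iUnion.1 hy
        refine Or.inr (mem_iUnion.2 ⟨Nat.pair i n, ?_⟩)
        simp only [Nat.unpair_pair]
        exact ⟨y, hn, rfl⟩
    · exact Or.inl (Or.inl ⟨hx, h⟩)

/-! ### Plane projections and characteristic angles -/

/-- The orthogonal projection onto a plane, in isometric coordinates of the plane. -/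
noncomputable def planeProjection (P : Submodule ℝ E4) (hP : Module.finrank ℝ P = 2) :
    E4 →L[ℝ] E2 :=
  (planeIsometry P hP).toLinearIsometry.toContinuousLinearMap ∘L P.orthogonalProjectionOnto

theorem norm_planeProjection (P : Submodule ℝ E4) (hP : Module.finrank ℝ P = 2) (x : E4) :
    ‖planeProjection P hP x‖ = ‖P.starProjection x‖ :=
  (planeIsometry P hP).norm_map (P.orthogonalProjectionOnto x)

theorem pi_le_volume_planeProjection_image (P : Submodule ℝ E4) (hP : Module.finrank ℝ P = 2)
    {E : Set E4} (h : Metric.ball (0 : E4) 1 ∩ (P : Set E4) ⊆ P.starProjection '' E) :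
    ENNReal.ofReal Real.pi ≤ volume (planeProjection P hP '' E) := by
  have hball : volume (Metric.ball (0 : E2) 1) = ENNReal.ofReal Real.pi := by
    rw [EuclideanSpace.volume_ball_fin_two]; simp
  rw [← hball]
  refine measure_mono fun z hz => ?_
  let J := planeIsometry P hP
  obtain ⟨x, hx, hxz⟩ := h (show ((J.symm z : P) : E4) ∈ _ from
    ⟨by
      rw [mem_ball_zero_iff] at hz ⊢
      exact (J.symm.norm_map z).trans_lt hz, (J.symm z).2⟩)
  refine ⟨x, hx, ?_⟩
  have : P.orthogonalProjectionOnto x = J.symm z := Subtype.ext hxz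
  change J (P.orthogonalProjectionOnto x) = z
  rw [this, J.apply_symm_apply]

theorem abs_det_planeProjection_add_le {P Q : Submodule ℝ E4} (hP : Module.finrank ℝ P = 2)
    (hQ : Module.finrank ℝ Q = 2) {c : ℝ} (hc : 0 ≤ c)
    (hPQ : ∀ v ∈ P, ∀ w ∈ Q, inner ℝ v w ≤ c * ‖v‖ * ‖w‖) (U : E2 →ₗᵢ[ℝ] E4) :
    |(planeProjection P hP ∘L U.toContinuousLinearMap).det| +
      |(planeProjection Q hQ ∘L U.toContinuousLinearMap).det| ≤ 1 + c := by
  have h1 := abs_det_le_norm_mul_norm (planeProjection P hP ∘L U.toContinuousLinearMap)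
  have h2 := abs_det_le_norm_mul_norm (planeProjection Q hQ ∘L U.toContinuousLinearMap)
  simp only [ContinuousLinearMap.comp_apply, norm_planeProjection] at h1 h2
  have hu : ∀ i : Fin 2, ‖U.toContinuousLinearMap (EuclideanSpace.single i 1)‖ = 1 := by
    intro i; simp
  have h3 := norm_sq_starProjection_add_le hc hPQ (hu 0)
  have h4 := norm_sq_starProjection_add_le hc hPQ (hu 1)
  linarith [two_mul_le_add_sq ‖P.starProjection (U.toContinuousLinearMap (EuclideanSpace.single 0 1))‖
      ‖P.starProjection (U.toContinuousLinearMap (EuclideanSpace.single 1 1))‖,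
    two_mul_le_add_sq ‖Q.starProjection (U.toContinuousLinearMap (EuclideanSpace.single 0 1))‖
      ‖Q.starProjection (U.toContinuousLinearMap (EuclideanSpace.single 1 1))‖]

theorem AreCharacteristicAngles.inner_le {P Q : Submodule ℝ E4} {α₁ α₂ c : ℝ} (hc0 : 0 ≤ c)
    (h : AreCharacteristicAngles P Q α₁ α₂) (hα : Real.arccos c ≤ α₁)
    {v w : E4}
    (hv : v ∈ P) (hw : w ∈ Q) : inner ℝ v w ≤ c * ‖v‖ * ‖w‖ := by
  rcases eq_or_ne v 0 with rfl | hv0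
  · simp
  rcases eq_or_ne w 0 with rfl | hw0
  · simp
  obtain ⟨v₁, w₁, -, hmin, rfl, -⟩ := h
  have hnv := norm_pos_iff.2 hv0
  have hnw := norm_pos_iff.2 hw0
  have h1 := hmin (‖v‖⁻¹ • v) (‖w‖⁻¹ • w) ⟨P.smul_mem _ hv, Q.smul_mem _ hw,
    by rw [norm_smul, norm_inv, norm_norm, inv_mul_cancel₀ hnv.ne'],
    by rw [norm_smul, norm_inv, norm_norm, inv_mul_cancel₀ hnw.ne']⟩
  rw [InnerProductGeometry.angle_smul_left_of_pos _ _ (inv_pos.2 hnv),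
    InnerProductGeometry.angle_smul_right_of_pos _ _ (inv_pos.2 hnw)] at h1
  have h2 := hα.trans h1
  have h3 : Real.cos (InnerProductGeometry.angle v w) ≤ c := by
    -- For `c > 1` the value `arccos c = 0` carries no information, but then `cos ≤ 1 ≤ c`.
    rcases le_total c 1 with hc | hc
    · rw [← Real.cos_arccos (by linarith) hc]
      exact Real.cos_le_cos_of_nonneg_of_le_pi (Real.arccos_nonneg _)
        (InnerProductGeometry.angle_le_pi _ _) h2
    · exact (Real.cos_le_one _).trans hc
  rw [← InnerProductGeometry.cos_angle_mul_norm_mul_norm, mul_assoc]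
  gcongr

theorem corollary2p45 (ε α₁ α₂ : ℝ) (hε : 0 < ε)
    (hα₁ : Real.arccos (ε / 2) ≤ α₁) (hα₂ : α₁ ≤ α₂)
    (P₁ P₂ : Submodule ℝ E4)
    (hP₁ : Module.finrank ℝ P₁ = 2) (hP₂ : Module.finrank ℝ P₂ = 2)
    (hangles : AreCharacteristicAngles P₁ P₂ α₁ α₂)
    (E : Set E4) (hclosed : IsClosed E) (hrect : IsRectifiable 2 E)
    (hproj₁ : Metric.ball (0 : E4) 1 ∩ (P₁ : Set E4) ⊆ P₁.starProjection '' E)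
    (hproj₂ : Metric.ball (0 : E4) 1 ∩ (P₂ : Set E4) ⊆ P₂.starProjection '' E) :
    ENNReal.ofReal (2 * Real.pi / (1 + ε)) ≤ μHE[2] E := by
  have hdet : ∀ U : E2 →ₗᵢ[ℝ] E4,
      |(planeProjection P₁ hP₁ ∘L U.toContinuousLinearMap).det| +
        |(planeProjection P₂ hP₂ ∘L U.toContinuousLinearMap).det| < (1 + ε).toNNReal := by
    intro U
    rw [Real.coe_toNNReal _ (by linarith)]
    have := abs_det_planeProjection_add_le hP₁ hP₂ (by linarith)
      (fun v hv w hw => hangles.inner_le (by linarith) hα₁ hv hw) U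
    linarith
  have hmain := hrect.volume_image_add_le hdet hclosed.measurableSet
  have h₁ := pi_le_volume_planeProjection_image P₁ hP₁ hproj₁
  have h₂ := pi_le_volume_planeProjection_image P₂ hP₂ hproj₂
  rw [ENNReal.ofReal_div_of_pos (by linarith)]
  refine ENNReal.div_le_of_le_mul' ?_
  rw [two_mul, ENNReal.ofReal_add Real.pi_nonneg Real.pi_nonneg]
  exact (add_le_add h₁ h₂).trans hmain
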